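/- Let $n\ge 2$. For $k\ge 1$ let $\mathbf s:\mathbb C^k\to\mathbb C^k$ be the map whose components are the elementary symmetric polynomials $s_1,\dots,s_k$, let $\Gamma_k=\mathbf s(\overline{\mathbb D}^k)$ be the closed symmetrized polydisc and $b\Gamma_k=\mathbf s(\mathbb T^k)$ its distinguished boundary. Operators are bounded linear operators on complex Hilbert spaces, and $\sigma$ denotes the (Taylor) joint spectrum of a commuting tuple. A commuting tuple $(S_1,\dots,S_n)$ on $\mathcal H$ is a *$\Gamma_n$-contraction* if $\sigma(S_1,\dots,S_n)\subseteq\Gamma_n$ and the functional calculus $\mathcal O(\Gamma_n)\to\mathcal B(\mathcal H)$ on functions holomorphic in a neighbourhood of $\Gamma_n$ is contractive for the supremum norm over $\Gamma_n$. A *$\Gamma_n$-unitary* is a commuting tuple of normal operators with joint spectrum in $b\Gamma_n$; a *$\Gamma_n$-isometry* is the restriction of a $\Gamma_n$-unitary to a common invariant closed subspace. A *$\Gamma_n$-isometric dilation* of $(S_1,\dots,S_n)$ is a $\Gamma_n$-isometry $(V_1,\dots,V_n)$ on a Hilbert space $\mathcal K\supseteq\mathcal H$ with $P_{\mathcal H}V_1^{m_1}\cdots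 V_n^{m_n}|_{\mathcal H}=S_1^{m_1}\cdots S_n^{m_n}$ for all integers $m_1,\dots,m_n\ge 0$. Let $(S_1,\dots,S_n)$ be a $\Gamma_n$-contraction on $\mathcal H$, let $D_{S_n}=(I-S_n^*S_n)^{1/2}$ and $\mathcal D_{S_n}=\overline{\operatorname{Ran}}\,D_{S_n}$, and let $E_1,\dots,E_{n-1}\in\mathcal B(\mathcal D_{S_n})$ be its fundamental operators, i.e. $S_i-S_{n-i}^*S_n=D_{S_n}E_iD_{S_n}$ for $i=1,\dots,n-1$. Put $\gamma_i=\frac{n-i}{n}$. If $(S_1,\dots,S_n)$ has a $\Gamma_n$-isometric dilation, then all of the following hold. 1. There are a Hilbert space $\tilde{\mathcal H}$, an isometry $\Theta:\mathcal D_{S_n}\to\tilde{\mathcal H}$ and a commuting tuple $(\gamma_1\tilde S_1,\dots,\gamma_{n-1}\tilde S_{n-1})$ of operators on $\tilde{\mathcal H}$ such that $\gamma_iE_i=\Theta^*\gamma_i\tilde S_i\Theta$ for $i=1,\dots,n-1$, and $(\gamma_1\tilde S_1,\dots,\gamma_{n-1}\tilde S_{n-1})$ extends to a commuting tuple $(\gamma_1U_1,\dots,\gamma_{n-1}U_{n-1})$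 of normal operators on a Hilbert space containing $\tilde{\mathcal H}$, with $\sigma(\gamma_1U_1,\dots,\gamma_{n-1}U_{n-1})\subseteq\Gamma_{n-1}$. 2. For $i=1,\dots,n-1$, $\bigl(E_i^*D_{S_n}S_i-E_{n-i}^*D_{S_n}S_{n-i}\bigr)\big|_{\ker D_{S_n}}=0$. 3. For $i=1,\dots,n-1$, $\bigl(E_i^*E_{n-i}^*-E_{n-i}^*E_i^*\bigr)D_{S_n}S_n\big|_{\ker D_{S_n}}=0$. -/

import Mathlib

open scoped InnerProductSpace

/-!
Conventions. Tuples are indexed by `Fin`, so the entry with (zero-based) index `i` is the one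
usually written with subscript `i + 1`. A Hilbert space `K` containing `H` is given by a linear
isometry `J : H →ₗᵢ[ℂ] K`; then `J†` plays the role of the projection onto `H`, and an operator
`A` on `K` leaves (the copy of) `H` invariant with restriction `B` iff `A (J h) = J (B h)`.
-/

/-! ### The symmetrized polydisc -/

/-- The symmetrization map: the entry with index `i` is the elementary symmetric function of
degree `i + 1`. -/
def symmMap (n : ℕ) (z : Fin n → ℂ) : Fin n → ℂ := fun i =>
  ∑ t ∈ Finset.powersetCard ((i : ℕ) + 1) (Finset.univ : Finset (Fin n)), ∏ j ∈ t, z j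

/-- The closed symmetrized polydisc `Γ_n`. -/
def symPolydisc (n : ℕ) : Set (Fin n → ℂ) := symmMap n '' {z | ∀ j, ‖z j‖ ≤ 1}

/-- The distinguished boundary `bΓ_n`, the image of the `n`-torus. -/
def symPolydiscBoundary (n : ℕ) : Set (Fin n → ℂ) := symmMap n '' {z | ∀ j, ‖z j‖ = 1}

/-! ### The (Taylor) joint spectrum -/

section Spectrum

variable {H : Type*} [NormedAddCommGroup H] [InnerProductSpace ℂ H]

/-- The operators of the tuple commute pairwise. -/
def CommutingTuple {n : ℕ} (T : Fin n → (H →L[ℂ] H)) : Prop := ∀ i j, Commute (T i) (T j)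

/-- The differential of the Koszul complex of `T`. An element `x` of the total space
`H ⊗ Λ(ℂⁿ)` is the family of its coefficients `x s` at `e_{s₁} ∧ ⋯ ∧ e_{s_p}`, where
`s = {s₁ < ⋯ < s_p}`, and `d (h ⊗ ω) = ∑ i, T i h ⊗ (e_i ∧ ω)`. -/
def koszulD {n : ℕ} (T : Fin n → (H →L[ℂ] H)) (x : Finset (Fin n) → H) :
    Finset (Fin n) → H := fun s =>
  ∑ i ∈ s, (-1 : ℂ) ^ (s.filter (fun j => j < i)).card • T i (x (s.erase i))

/-- The Taylor joint spectrum of a commuting tuple: the points `μ` at which the Koszul complex of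
`T - μ` is not exact. (The differential is homogeneous of degree one, so exactness in every degree
is exactness of the total complex.) -/
def jointSpectrum {n : ℕ} (T : Fin n → (H →L[ℂ] H)) : Set (Fin n → ℂ) :=
  {μ | ¬ Function.Exact (koszulD fun i => T i - μ i • (1 : H →L[ℂ] H))
        (koszulD fun i => T i - μ i • (1 : H →L[ℂ] H))}

end Spectrum

/-! ### Spectral sets and `Γ_n`-contractions -/

/-- `𝒪(Ω)`: the algebra of functions that are holomorphic on a neighbourhood of `Ω`. -/
def holAlg {n : ℕ} (Ω : Set (Fin n → ℂ)) : Subalgebra ℂ ((Fin n → ℂ) → ℂ) where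
  carrier := {f | AnalyticOnNhd ℂ f Ω}
  mul_mem' hf hg := hf.mul hg
  add_mem' hf hg := hf.add hg
  algebraMap_mem' _ := analyticOnNhd_const

/-- The coordinate functions, as elements of `𝒪(Ω)`. -/
def holCoord {n : ℕ} (Ω : Set (Fin n → ℂ)) (i : Fin n) : holAlg Ω :=
  ⟨fun z => z i, (ContinuousLinearMap.proj (R := ℂ) (φ := fun _ : Fin n => ℂ) i).analyticOnNhd Ω⟩

section Contraction

variable {H : Type*} [NormedAddCommGroup H] [InnerProductSpace ℂ H]

/-- `S` is a `Γ_n`-contraction: a commuting tuple with `σ(S) ⊆ Γ_n` for which the functional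
calculus `𝒪(Γ_n) → ℬ(H)`, a unital algebra homomorphism that maps the coordinates to the operators
`S i`, is contractive for the supremum norm over `Γ_n`. (As `Γ_n` is polynomially convex, a
contractive homomorphism is determined by its values on the coordinates.) -/
def IsGammaContraction {n : ℕ} (S : Fin n → (H →L[ℂ] H)) : Prop :=
  CommutingTuple S ∧ jointSpectrum S ⊆ symPolydisc n ∧
    ∃ ρ : holAlg (symPolydisc n) →ₐ[ℂ] (H →L[ℂ] H),
      (∀ i, ρ (holCoord (symPolydisc n) i) = S i) ∧
      ∀ f : holAlg (symPolydisc n),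
        ‖ρ f‖ ≤ ⨆ z : symPolydisc n, ‖(f : (Fin n → ℂ) → ℂ) z‖

end Contraction

/-! ### `Γ_n`-unitaries, `Γ_n`-isometries and dilations -/

universe u v w

section Dilation

variable {H : Type u} [NormedAddCommGroup H] [InnerProductSpace ℂ H] [CompleteSpace H]

/-- A `Γ_n`-unitary: a commuting tuple of normal operators with joint spectrum in `bΓ_n`. -/
def IsGammaUnitary {n : ℕ} (U : Fin n → (H →L[ℂ] H)) : Prop :=
  CommutingTuple U ∧ (∀ i, IsStarNormal (U i)) ∧ jointSpectrum U ⊆ symPolydiscBoundary n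

/-- A `Γ_n`-isometry: a commuting tuple that is the restriction of a `Γ_n`-unitary to a common
invariant subspace. -/
def IsGammaIsometry {K : Type v} [NormedAddCommGroup K] [InnerProductSpace ℂ K] {n : ℕ}
    (V : Fin n → (K →L[ℂ] K)) : Prop :=
  CommutingTuple V ∧
    ∃ (L : Type w) (_ : NormedAddCommGroup L) (_ : InnerProductSpace ℂ L) (_ : CompleteSpace L)
      (J : K →ₗᵢ[ℂ] L) (U : Fin n → (L →L[ℂ] L)),
      IsGammaUnitary U ∧ ∀ i x, U i (J x) = J (V i x)

/-- `V`, acting on `K ⊇ H`, is a `Γ_n`-isometric dilation of `S`: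
`P_H V₁^{m₁} ⋯ Vₙ^{mₙ}|_H = S₁^{m₁} ⋯ Sₙ^{mₙ}` for all exponents. -/
def IsGammaIsometricDilation {K : Type v} [NormedAddCommGroup K] [InnerProductSpace ℂ K]
    [CompleteSpace K] {n : ℕ} (S : Fin n → (H →L[ℂ] H)) (J : H →ₗᵢ[ℂ] K)
    (V : Fin n → (K →L[ℂ] K)) : Prop :=
  IsGammaIsometry.{v, w} V ∧
    ∀ m : Fin n → ℕ,
      (ContinuousLinearMap.adjoint J.toContinuousLinearMap) ∘L
          (List.ofFn fun i => V i ^ m i).prod ∘L J.toContinuousLinearMap =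
        (List.ofFn fun i => S i ^ m i).prod

/-- `S` has a `Γ_n`-isometric dilation. -/
def HasGammaIsometricDilation {n : ℕ} (S : Fin n → (H →L[ℂ] H)) : Prop :=
  ∃ (K : Type v) (_ : NormedAddCommGroup K) (_ : InnerProductSpace ℂ K) (_ : CompleteSpace K)
    (J : H →ₗᵢ[ℂ] K) (V : Fin n → (K →L[ℂ] K)), IsGammaIsometricDilation.{u, v, w} S J V

end Dilation

/-! ### Defect operators and fundamental operators -/

section Defect

variable {H : Type*} [NormedAddCommGroup H] [InnerProductSpace ℂ H] [CompleteSpace H]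

/-- The defect operator `D_T = (I - T* T)^{1/2}` of a contraction `T`. -/
noncomputable def defectOp (T : H →L[ℂ] H) : H →L[ℂ] H :=
  CFC.sqrt (1 - ContinuousLinearMap.adjoint T * T)

/-- The defect space `𝒟_T`, the closure of the range of `D_T`. -/
noncomputable abbrev defectSpace (T : H →L[ℂ] H) : Submodule ℂ H :=
  (LinearMap.range (defectOp T).toLinearMap).topologicalClosure

/-- `D_T` as an operator from `H` to `𝒟_T`. -/
noncomputable def defectMap (T : H →L[ℂ] H) : H →L[ℂ] defectSpace T :=
  (defectOp T).codRestrict (defectSpace T)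
    fun x => Submodule.le_topologicalClosure _ ⟨x, rfl⟩

/-- `E` is the tuple of fundamental operators of `S = (S_1, …, S_n)`, `n = m + 1`. Here
`S_i`, `S_{n-i}`, `S_n` are `S i.castSucc`, `S i.rev.castSucc`, `S (Fin.last m)`, the operator
`E_{n-i}` is `E i.rev`, and the equations are `S_i - S_{n-i}* S_n = D_{S_n} E_i D_{S_n}` for all
`i = 1, …, n - 1` (the equation for `E_{n-i}` is the one with `n - i` in place of `i`). -/
def IsFundamentalTuple {m : ℕ} (S : Fin (m + 1) → (H →L[ℂ] H))
    (E : Fin m → (defectSpace (S (Fin.last m)) →L[ℂ] defectSpace (S (Fin.last m)))) : Prop :=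
  ∀ i : Fin m,
    S i.castSucc - ContinuousLinearMap.adjoint (S i.rev.castSucc) * S (Fin.last m) =
      defectOp (S (Fin.last m)) ∘L (defectSpace (S (Fin.last m))).subtypeL ∘L E i ∘L
        defectMap (S (Fin.last m))

end Defect

/-- The number `γ_k = (n - k) / n` with `n = m + 1` and `k = i + 1`. -/
noncomputable def gammaCoeff (m : ℕ) (i : Fin m) : ℂ :=
  (((m + 1 : ℕ) : ℂ) - ((i : ℕ) + 1 : ℕ)) / ((m + 1 : ℕ) : ℂ)

/-! ### The symmetrization map -/

section SymmMap

open Polynomial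

/-! Let `N` be the largest subspace of the dilation space that is invariant under `V` and orthogonal
to `H`. The dilation identity makes `H ⊕ N` invariant, and there `V_j` has the block form `(S_j, 0;
C_j, Z_j)` with `Z_j = V_j|_N` (`sub_mem_invariantComplement`).

Characters of a commutative C⋆-algebra containing the `Γ_n`-unitary transfer identities on the torus
to operators (`IsGammaUnitary.relations`), so `V_n` is isometric and `V_i = V_{n-i}* V_n`. In block
form this reads `C_n* C_n = D²`, `C_i = Z_{n-i}* C_n` and `S_i - S_{n-i}* S_n = C_{n-i}* C_n`, where
`D = D_{S_n}`. Hence `C_n = Θ D` for an isometry `Θ`, and `D E_i D = C_n* Z_i C_n` gives `E_i = Θ*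
Z_i Θ`. Every `C_j` vanishes on `ker D`, so commutativity of `V` reduces there to `C_i S_j = C_j
S_i`; since `E_i* D = Θ* C_{n-i}`, the two kernel identities follow
(`fundamentalTuple_of_lowerTriangular`).

The `Z_i` are restrictions of the normal `U_i`. The joint spectrum of the `γ_i U_i` consists of
character values, and Gauss–Lucas places these in `Γ_{n-1}`. -/

theorem symmMap_eq_coeff (n : ℕ) (z : Fin n → ℂ) (i : Fin n) :
    symmMap n z i = (∏ j, (X + C (z j))).coeff (n - ((i : ℕ) + 1)) := by
  rw [Finset.prod_X_add_C_coeff _ _ (by simp)]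
  simp only [Finset.card_univ, Fintype.card_fin, symmMap]
  rw [Nat.sub_sub_self (by omega)]

theorem symmMap_last (m : ℕ) (z : Fin (m + 1) → ℂ) :
    symmMap (m + 1) z (Fin.last m) = ∏ j, z j := by
  have h : Finset.powersetCard (m + 1) (Finset.univ : Finset (Fin (m + 1))) = {Finset.univ} := by
    convert Finset.powersetCard_self (Finset.univ : Finset (Fin (m + 1)))
    simp
  simp [symmMap, h]

/-- On the torus, `s_k = conj s_{n-k} * s_n`. -/
theorem symmMap_eq_conj_mul {m : ℕ} {z : Fin (m + 1) → ℂ} (hz : ∀ j, ‖z j‖ = 1) (i : Fin m) :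
    symmMap (m + 1) z i.castSucc =
      star (symmMap (m + 1) z i.rev.castSucc) * symmMap (m + 1) z (Fin.last m) := by
  rw [symmMap_last]
  simp only [symmMap, star_sum, star_prod, Finset.sum_mul]
  -- Unimodularity turns the conjugate of a product over `tᶜ`, times the product of all `z j`, into
  -- the product over `t`.
  refine Finset.sum_nbij' (fun t => tᶜ) (fun t => tᶜ) ?_ ?_ (by simp) (by simp) ?_
  · intro t ht
    simp only [Finset.mem_powersetCard_univ, Fin.val_castSucc, Fin.val_rev] at ht ⊢
    rw [Finset.card_compl, ht, Fintype.card_fin]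
    omega
  · intro t ht
    simp only [Finset.mem_powersetCard_univ, Fin.val_castSucc, Fin.val_rev] at ht ⊢
    rw [Finset.card_compl, ht, Fintype.card_fin]
    omega
  · intro t _
    rw [← Finset.prod_compl_mul_prod t, ← mul_assoc, ← Finset.prod_mul_distrib]
    have : ∀ j ∈ tᶜ, star (z j) * z j = 1 := fun j _ => by
      rw [Complex.star_def, ← Complex.normSq_eq_conj_mul_self, Complex.normSq_eq_norm_sq, hz]
      simp
    rw [Finset.prod_congr rfl this]
    simp

theorem star_mul_symmMap_last {m : ℕ} {z : Fin (m + 1) → ℂ} (hz : ∀ j, ‖z j‖ = 1) :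
    star (symmMap (m + 1) z (Fin.last m)) * symmMap (m + 1) z (Fin.last m) = 1 := by
  rw [Complex.star_def, ← Complex.normSq_eq_conj_mul_self, Complex.normSq_eq_norm_sq,
    symmMap_last, norm_prod]
  simp [hz]

theorem exists_fin_map_eq {α : Type*} (s : Multiset α) {n : ℕ} (h : s.card = n) :
    ∃ w : Fin n → α, (Finset.univ : Finset (Fin n)).val.map w = s := by
  subst h
  refine ⟨fun i => s.toList.get (i.cast (by simp)), ?_⟩
  conv_rhs => rw [← Multiset.coe_toList s]
  rw [Fin.univ_val_map, Multiset.coe_eq_coe]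
  refine List.Perm.of_eq ?_
  apply List.ext_get <;> simp

/-- By the Gauss–Lucas theorem, the scaled projection `(γ_1 s_1, …, γ_{n-1} s_{n-1})` maps the
symmetrized polydisc `Γ_n` into `Γ_{n-1}`. -/
theorem gammaCoeff_mul_mem_symPolydisc {m : ℕ} {s : Fin (m + 1) → ℂ}
    (hs : s ∈ symPolydisc (m + 1)) :
    (fun i : Fin m => gammaCoeff m i * s i.castSucc) ∈ symPolydisc m := by
  obtain ⟨z, hz, rfl⟩ := hs
  simp only [Set.mem_ofPred_eq] at hz
  -- Roots at `-z j` keep the coefficients free of signs; accordingly `w` below lists the negatives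
  -- of the roots of `p'`.
  set p : ℂ[X] := ∏ j, (X + C (z j)) with hp
  have hmonic : p.Monic := monic_prod_of_monic _ _ fun j _ => monic_X_add_C _
  have hdeg : p.natDegree = m + 1 := by
    rw [hp, natDegree_prod_of_monic _ _ fun j _ => monic_X_add_C _]
    simp
  have hdeg' : p.derivative.natDegree = m := by
    rw [natDegree_derivative, hdeg, Nat.add_sub_cancel]
  have hlead : p.derivative.leadingCoeff = (m : ℂ) + 1 := by
    rw [leadingCoeff, hdeg', coeff_derivative, ← hdeg, hmonic.coeff_natDegree, one_mul]
  have hsplit := IsAlgClosed.splits p.derivative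
  have hcard : p.derivative.roots.card = m := by
    rw [splits_iff_card_roots.1 hsplit, hdeg']
  obtain ⟨w, hw⟩ := exists_fin_map_eq (p.derivative.roots.map Neg.neg) (n := m)
    (by simpa using hcard)
  have hroots : p.derivative.roots = (Finset.univ : Finset (Fin m)).val.map fun i => - w i := by
    rw [show (fun i => - w i) = Neg.neg ∘ w from rfl, ← Multiset.map_map, hw, Multiset.map_map]
    simp
  have hfac : p.derivative = C ((m : ℂ) + 1) * ∏ j, (X + C (w j)) := by
    conv_lhs => rw [← C_leadingCoeff_mul_prod_multiset_X_sub_C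
      (splits_iff_card_roots.1 hsplit), hlead, hroots]
    rw [Multiset.map_map]
    simp [Finset.prod]
  have hm1 : (m : ℂ) + 1 ≠ 0 := by exact_mod_cast Nat.succ_ne_zero m
  have hp'0 : p.derivative ≠ 0 := by
    intro h
    rw [h, leadingCoeff_zero] at hlead
    exact hm1 hlead.symm
  refine ⟨w, fun j => ?_, ?_⟩
  · have hmem : - w j ∈ p.derivative.rootSet ℂ := by
      rw [mem_rootSet]
      refine ⟨hp'0, ?_⟩
      have : - w j ∈ p.derivative.roots := by
        rw [hroots]
        exact Multiset.mem_map.2 ⟨j, by simp, rfl⟩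
      simpa using (mem_roots'.1 this).2
    have hball : p.rootSet ℂ ⊆ Metric.closedBall 0 1 := by
      intro x hx
      have hx := (mem_rootSet.1 hx).2
      simp only [coe_aeval_eq_eval, hp, eval_prod, eval_add, eval_X, eval_C,
        Finset.prod_eq_zero_iff] at hx
      obtain ⟨k, -, hk⟩ := hx
      rw [mem_closedBall_zero_iff, eq_neg_of_add_eq_zero_left hk, norm_neg]
      exact hz k
    have := convexHull_min hball (convex_closedBall 0 1)
      (rootSet_derivative_subset_convexHull_rootSet
        (natDegree_pos_iff_degree_pos.1 (by omega)) hmem)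
    simpa using this
  · ext i
    -- Comparing coefficients in `p' = (m + 1) ∏ (X + w j)` gives `(m + 1) s_{i+1}(w) = (m - i)
    -- s_{i+1}(z)`, and `γ = (m - i) / (m + 1)`.
    have h1 := coeff_derivative p (m - ((i : ℕ) + 1))
    rw [hfac, coeff_C_mul, ← symmMap_eq_coeff,
      show m - ((i : ℕ) + 1) + 1 = (m + 1) - ((i.castSucc : ℕ) + 1) by simp; omega, hp,
      ← symmMap_eq_coeff] at h1
    have h2 : ((m - ((i : ℕ) + 1) : ℕ) : ℂ) = (m : ℂ) - ((i : ℂ) + 1) := by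
      rw [Nat.cast_sub (by omega)]
      push_cast
      ring
    rw [h2] at h1
    simp only [gammaCoeff]
    push_cast
    field_simp
    linear_combination h1

theorem symPolydiscBoundary_subset (n : ℕ) : symPolydiscBoundary n ⊆ symPolydisc n :=
  Set.image_mono fun _ hz j => (hz j).le

end SymmMap

/-! ### The Koszul complex -/

section Koszul

variable {H : Type*} [NormedAddCommGroup H] [InnerProductSpace ℂ H]

/-- The sign with which `e_i` is moved into place in `e_{s₁} ∧ ⋯ ∧ e_{s_p}`. -/
def koszulSign {n : ℕ} (s : Finset (Fin n)) (i : Fin n) : ℂ :=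
  (-1) ^ (s.filter (fun j => j < i)).card

theorem koszulSign_mul_self {n : ℕ} (s : Finset (Fin n)) (i : Fin n) :
    koszulSign s i * koszulSign s i = 1 := by
  rw [koszulSign, ← mul_pow]
  simp

theorem koszulSign_erase {n : ℕ} {s : Finset (Fin n)} {i : Fin n} (hi : i ∈ s) (j : Fin n) :
    koszulSign (s.erase i) j = (if i < j then -1 else 1) * koszulSign s j := by
  unfold koszulSign
  rw [Finset.filter_erase]
  split_ifs with h
  · have hmem : i ∈ s.filter (fun k => k < j) := by simp [hi, h]
    have := Finset.card_erase_add_one hmem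
    rw [← this, pow_succ]
    ring
  · rw [Finset.erase_eq_of_notMem (by simp [h]), one_mul]

theorem koszulSign_insert {n : ℕ} {s : Finset (Fin n)} {i : Fin n} (hi : i ∉ s) (j : Fin n) :
    koszulSign (insert i s) j = (if i < j then -1 else 1) * koszulSign s j := by
  have h := koszulSign_erase (Finset.mem_insert_self i s) j
  rw [Finset.erase_insert hi] at h
  rw [h, ← mul_assoc]
  split_ifs <;> simp

theorem koszulD_apply {n : ℕ} (T : Fin n → (H →L[ℂ] H)) (x : Finset (Fin n) → H)
    (s : Finset (Fin n)) :
    koszulD T x s = ∑ i ∈ s, koszulSign s i • T i (x (s.erase i)) := rfl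

theorem koszulD_koszulD {n : ℕ} {T : Fin n → (H →L[ℂ] H)} (hT : CommutingTuple T)
    (x : Finset (Fin n) → H) : koszulD T (koszulD T x) = 0 := by
  ext s
  simp only [koszulD_apply, map_sum, map_smul, Finset.smul_sum, smul_smul, Pi.zero_apply]
  -- Padding the diagonal with zeros lets both sums run over `s`; the double sum is then
  -- antisymmetric, hence equal to its own negative.
  set f : Fin n → Fin n → H := fun i j => if j = i then 0 else
    (koszulSign s i * koszulSign (s.erase i) j) • T i (T j (x ((s.erase i).erase j))) with hf
  have h1 : ∑ i ∈ s, ∑ j ∈ s.erase i, (koszulSign s i * koszulSign (s.erase i) j) •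
      T i (T j (x ((s.erase i).erase j))) = ∑ i ∈ s, ∑ j ∈ s, f i j := by
    refine Finset.sum_congr rfl fun i hi => ?_
    rw [← Finset.add_sum_erase s (f i) hi]
    simp only [hf, if_true, zero_add]
    exact Finset.sum_congr rfl fun j hj => by rw [if_neg (Finset.ne_of_mem_erase hj)]
  have h2 : ∀ i ∈ s, ∀ j ∈ s, f i j = - f j i := by
    intro i hi j hj
    rcases eq_or_ne i j with rfl | hij
    · simp [hf]
    · simp only [hf, if_neg hij, if_neg hij.symm, koszulSign_erase hi, koszulSign_erase hj]
      have hc : T i (T j (x ((s.erase i).erase j))) = T j (T i (x ((s.erase j).erase i))) := by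
        rw [Finset.erase_right_comm]
        exact congr($(hT i j) (x ((s.erase j).erase i)))
      rw [hc, ← neg_smul]
      congr 1
      rcases lt_or_gt_of_ne hij with h | h
      · rw [if_pos h, if_neg h.not_gt]
        ring
      · rw [if_pos h, if_neg h.not_gt]
        ring
  rw [h1]
  have h3 : ∑ i ∈ s, ∑ j ∈ s, f i j = - ∑ i ∈ s, ∑ j ∈ s, f i j := by
    conv_lhs => rw [Finset.sum_comm]
    rw [← Finset.sum_neg_distrib]
    refine Finset.sum_congr rfl fun i hi => ?_
    rw [← Finset.sum_neg_distrib]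
    exact Finset.sum_congr rfl fun j hj => h2 j hj i hi
  have h4 : (2 : ℂ) • ∑ i ∈ s, ∑ j ∈ s, f i j = 0 := by
    rw [two_smul]
    exact eq_neg_iff_add_eq_zero.1 h3
  exact (smul_eq_zero.1 h4).resolve_left two_ne_zero

/-- Contraction in the Koszul complex against the tuple `B`. -/
def koszulContract {n : ℕ} (B : Fin n → (H →L[ℂ] H)) (x : Finset (Fin n) → H) :
    Finset (Fin n) → H := fun s =>
  ∑ i ∈ sᶜ, koszulSign s i • B i (x (insert i s))

/-- The diagonal terms contribute `T i * B i` once for each `i`, from the first composite if `i ∈ s`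
and from the second otherwise; the mixed terms cancel in sign. When `∑ T i * B i = 1`, the
contraction is a contracting homotopy. -/
theorem koszulD_contract_add {n : ℕ} {T B : Fin n → (H →L[ℂ] H)}
    (hTB : ∀ i j, Commute (T i) (B j)) (x : Finset (Fin n) → H) :
    koszulD T (koszulContract B x) + koszulContract B (koszulD T x) =
      fun s => ∑ i, T i (B i (x s)) := by
  ext s
  simp only [koszulD_apply, koszulContract, Pi.add_apply, map_sum, map_smul, Finset.smul_sum,
    smul_smul]
  have h1 : ∀ i ∈ s, ∑ j ∈ (s.erase i)ᶜ, (koszulSign s i * koszulSign (s.erase i) j) •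
        T i (B j (x (insert j (s.erase i)))) =
      T i (B i (x s)) + ∑ j ∈ sᶜ, (koszulSign s i * koszulSign (s.erase i) j) •
        T i (B j (x (insert j (s.erase i)))) := by
    intro i hi
    rw [Finset.compl_erase, Finset.sum_insert (by simpa using hi), koszulSign_erase hi,
      if_neg (lt_irrefl i), one_mul, koszulSign_mul_self, one_smul, Finset.insert_erase hi]
  have h2 : ∀ j ∈ sᶜ, ∑ i ∈ insert j s, (koszulSign s j * koszulSign (insert j s) i) •
        B j (T i (x ((insert j s).erase i))) =
      T j (B j (x s)) + ∑ i ∈ s, (koszulSign s j * koszulSign (insert j s) i) •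
        B j (T i (x ((insert j s).erase i))) := by
    intro j hj
    have hj' : j ∉ s := by simpa using hj
    rw [Finset.sum_insert hj', koszulSign_insert hj',
      if_neg (lt_irrefl j), one_mul, koszulSign_mul_self, one_smul, Finset.erase_insert hj']
    congr 1
    exact congr($((hTB j j).symm) (x s))
  rw [Finset.sum_congr rfl h1, Finset.sum_congr rfl h2, Finset.sum_add_distrib,
    Finset.sum_add_distrib, add_add_add_comm, Finset.sum_add_sum_compl, Finset.sum_comm,
    ← Finset.sum_add_distrib]
  rw [Finset.sum_eq_zero (s := sᶜ), add_zero]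
  intro j hj
  have hj' : j ∉ s := by simpa using hj
  rw [← Finset.sum_add_distrib]
  refine Finset.sum_eq_zero fun i hi => ?_
  have hij : i ≠ j := by rintro rfl; exact hj' hi
  have hc : B j (T i (x ((insert j s).erase i))) = T i (B j (x (insert j (s.erase i)))) := by
    rw [Finset.erase_insert_of_ne hij.symm]
    exact congr($((hTB i j).symm) (x (insert j (s.erase i))))
  rw [hc, ← add_smul, koszulSign_erase hi, koszulSign_insert hj']
  convert zero_smul ℂ _ using 2
  rcases lt_or_gt_of_ne hij with h | h
  · rw [if_pos h, if_neg h.not_gt]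
    ring
  · rw [if_pos h, if_neg h.not_gt]
    ring

/-- The Koszul complex is exact if the identity is a combination of the operators with
coefficients that commute with them. -/
theorem koszulD_exact {n : ℕ} {T B : Fin n → (H →L[ℂ] H)} (hT : CommutingTuple T)
    (hTB : ∀ i j, Commute (T i) (B j)) (h1 : ∑ i, T i * B i = 1) :
    Function.Exact (koszulD T) (koszulD T) := by
  intro x
  refine ⟨fun hx => ⟨koszulContract B x, ?_⟩, ?_⟩
  · have h := koszulD_contract_add hTB x
    have h0 : koszulContract B (0 : Finset (Fin n) → H) = 0 := by
      ext s
      simp [koszulContract]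
    rw [hx, h0, add_zero] at h
    rw [h]
    ext s
    simpa using congr($h1 (x s))
  · rintro ⟨y, rfl⟩
    exact koszulD_koszulD hT y

/-- The Koszul differential as a bounded operator. -/
noncomputable def koszulCLM {n : ℕ} (T : Fin n → (H →L[ℂ] H)) :
    (Finset (Fin n) → H) →L[ℂ] (Finset (Fin n) → H) :=
  ContinuousLinearMap.pi fun s =>
    ∑ i ∈ s, koszulSign s i • (T i ∘L ContinuousLinearMap.proj (s.erase i))

theorem koszulCLM_apply {n : ℕ} (T : Fin n → (H →L[ℂ] H)) (x : Finset (Fin n) → H) :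
    koszulCLM T x = koszulD T x := by
  ext s
  simp [koszulCLM, koszulD_apply]

/-- Exactness of the Koszul complex implies that the tuple is jointly bounded below. -/
theorem exists_norm_le_of_koszulD_exact [CompleteSpace H] {n : ℕ} {T : Fin n → (H →L[ℂ] H)}
    (h : Function.Exact (koszulD T) (koszulD T)) :
    ∃ C > 0, ∀ x : H, ‖x‖ ≤ C * ∑ i, ‖T i x‖ := by
  set D := koszulCLM T
  have hmem : ∀ x, D x ∈ LinearMap.ker D.toLinearMap := fun x => by
    simp only [LinearMap.mem_ker, ContinuousLinearMap.coe_coe, D, koszulCLM_apply]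
    exact (h _).2 ⟨x, rfl⟩
  have hclosed : IsClosed (LinearMap.ker D.toLinearMap : Set (Finset (Fin n) → H)) :=
    D.isClosed_ker
  have : CompleteSpace (LinearMap.ker D.toLinearMap) := hclosed.completeSpace_coe
  set D' : (Finset (Fin n) → H) →L[ℂ] LinearMap.ker D.toLinearMap := D.codRestrict _ hmem
  have hsurj : Function.Surjective D' := by
    rintro ⟨y, hy⟩
    simp only [LinearMap.mem_ker, ContinuousLinearMap.coe_coe, D, koszulCLM_apply] at hy
    obtain ⟨x, hx⟩ := (h y).1 hy
    refine ⟨x, Subtype.ext ?_⟩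
    simpa [D', D, koszulCLM_apply] using hx
  -- The open mapping theorem, applied onto the closed kernel, provides the constant.
  obtain ⟨C, hC, hpre⟩ := D'.exists_preimage_norm_le hsurj
  refine ⟨C, hC, fun x => ?_⟩
  set ξ : Finset (Fin n) → H := Pi.single ∅ x with hξ
  obtain ⟨η, hη, hle⟩ := hpre (D' ξ)
  have hD : koszulD T (ξ - η) = 0 := by
    have := congr_arg Subtype.val hη
    simp only [D', ContinuousLinearMap.coe_codRestrict_apply] at this
    rw [← koszulCLM_apply, map_sub, sub_eq_zero]
    exact this.symm
  obtain ⟨ζ, hζ⟩ := (h _).1 hD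
  -- There are no boundaries in degree zero, so a cycle vanishes at `∅`: any preimage of `D' ξ` has
  -- the same degree-zero entry `x`.
  have hx : x = η ∅ := by
    have := congr_fun hζ ∅
    simp only [koszulD_apply, Finset.sum_empty, Pi.sub_apply, hξ, Pi.single_eq_same] at this
    exact (sub_eq_zero.1 this.symm)
  have hnorm : ‖D' ξ‖ ≤ ∑ i, ‖T i x‖ := by
    change ‖D ξ‖ ≤ _
    rw [pi_norm_le_iff_of_nonneg (Finset.sum_nonneg fun _ _ => norm_nonneg _)]
    intro s
    rw [koszulCLM_apply, koszulD_apply]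
    refine (norm_sum_le _ _).trans ?_
    refine (Finset.sum_le_sum (g := fun i => ‖T i x‖) fun i _ => ?_).trans
      (Finset.sum_le_sum_of_subset_of_nonneg (Finset.subset_univ s)
        fun _ _ _ => norm_nonneg _)
    rw [norm_smul, koszulSign, norm_pow, norm_neg, norm_one, one_pow, one_mul]
    rcases eq_or_ne (s.erase i) ∅ with he | he
    · simp [hξ, he]
    · simp [hξ, Pi.single_eq_of_ne he]
  calc ‖x‖ = ‖η ∅‖ := by rw [hx]
    _ ≤ ‖η‖ := norm_le_pi_norm η ∅
    _ ≤ C * ‖D' ξ‖ := hle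
    _ ≤ C * ∑ i, ‖T i x‖ := by gcongr

end Koszul

/-! ### The joint spectrum of a commuting tuple of normal operators -/

section Normal

open WeakDual

variable {H : Type*} [NormedAddCommGroup H] [InnerProductSpace ℂ H] [CompleteSpace H]

/-- By Fuglede's theorem, a commuting tuple of normal operators lies in a commutative C⋆-algebra. -/
theorem exists_commutative_starSubalgebra {n : ℕ} {T : Fin n → (H →L[ℂ] H)}
    (hT : CommutingTuple T) (hN : ∀ i, IsStarNormal (T i)) :
    ∃ A : StarSubalgebra ℂ (H →L[ℂ] H), IsClosed (A : Set (H →L[ℂ] H)) ∧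
      (∀ a b : A, a * b = b * a) ∧ ∀ i, T i ∈ A := by
  have : IsMulCommutative (StarAlgebra.adjoin ℂ (Set.range T)) := by
    refine StarAlgebra.isMulCommutative_adjoin ℂ ?_ ?_
    · rintro _ ⟨i, rfl⟩ _ ⟨j, rfl⟩
      exact hT i j
    · rintro _ ⟨i, rfl⟩ _ ⟨j, rfl⟩
      exact (hN j).commute_star_right (hT i j)
  refine ⟨(StarAlgebra.adjoin ℂ (Set.range T)).topologicalClosure,
    StarSubalgebra.isClosed_topologicalClosure _, ?_, fun i => ?_⟩
  · exact (StarSubalgebra.commRingTopologicalClosure _ this.is_comm.comm).mul_comm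
  · exact StarSubalgebra.le_topologicalClosure _
      (StarAlgebra.subset_adjoin ℂ _ ⟨i, rfl⟩)

variable {A : StarSubalgebra ℂ (H →L[ℂ] H)}

/-- The values of a character on a tuple belong to the joint spectrum. -/
theorem character_mem_jointSpectrum [IsClosed (A : Set (H →L[ℂ] H))] (φ : characterSpace ℂ A)
    {n : ℕ} (a : Fin n → A) :
    (fun i => φ (a i)) ∈ jointSpectrum fun i => (a i : H →L[ℂ] H) := by
  intro hex
  obtain ⟨C, hC, hle⟩ := exists_norm_le_of_koszulD_exact hex
  -- The character kills `∑ N i* N i`, yet a joint lower bound makes this sum invertible, and its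
  -- inverse stays in the C⋆-subalgebra `A`.
  set N : Fin n → A := fun i => a i - φ (a i) • 1 with hN
  have hφ : φ (∑ i, star (N i) * N i) = 0 := by
    simp [hN]
  have hunit : IsUnit ((∑ i, star (N i) * N i : A) : H →L[ℂ] H) := by
    -- Cauchy–Schwarz yields the factor `n`; `n + 1` keeps the constant positive when `n = 0`.
    set c : ℝ := (C ^ 2 * (n + 1))⁻¹ with hc
    have hcpos : 0 < c := by positivity
    refine ContinuousLinearMap.isUnit_of_forall_le_norm_inner_map _ (c := ⟨c, hcpos.le⟩) hcpos
      fun x => ?_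
    have hinner : ⟪((∑ i, star (N i) * N i : A) : H →L[ℂ] H) x, x⟫_ℂ
        = ((∑ i, ‖(N i : H →L[ℂ] H) x‖ ^ 2 : ℝ) : ℂ) := by
      have hsum : ((∑ i, star (N i) * N i : A) : H →L[ℂ] H) =
          ∑ i, star (N i : H →L[ℂ] H) * (N i : H →L[ℂ] H) :=
        map_sum A.subtype _ _
      rw [hsum, sum_apply, sum_inner, Complex.ofReal_sum]
      refine Finset.sum_congr rfl fun i _ => ?_
      rw [mul_apply_eq_comp, ContinuousLinearMap.star_eq_adjoint,
        ContinuousLinearMap.adjoint_inner_left, inner_self_eq_norm_sq_to_K]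
      simp
    rw [hinner, Complex.norm_real, Real.norm_of_nonneg (by positivity)]
    have h1 : ‖x‖ ^ 2 ≤ C ^ 2 * (n * ∑ i, ‖(N i : H →L[ℂ] H) x‖ ^ 2) := by
      calc ‖x‖ ^ 2 ≤ (C * ∑ i, ‖(N i : H →L[ℂ] H) x‖) ^ 2 := by
            gcongr
            exact hle x
        _ = C ^ 2 * (∑ i, ‖(N i : H →L[ℂ] H) x‖) ^ 2 := by ring
        _ ≤ _ := by
            gcongr
            simpa using sq_sum_le_card_mul_sum_sq (s := Finset.univ)
              (f := fun i => ‖(N i : H →L[ℂ] H) x‖)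
    change ‖x‖ ^ 2 * c ≤ _
    rw [hc, mul_inv_le_iff₀ (by positivity)]
    refine h1.trans ?_
    have : 0 ≤ C ^ 2 * ∑ i, ‖(N i : H →L[ℂ] H) x‖ ^ 2 := by positivity
    linarith
  exact ((A.coe_isUnit.1 hunit).map φ).ne_zero hφ

/-- Every point of the joint spectrum of a tuple in a commutative C⋆-algebra of operators is given
by a character. -/
theorem exists_character_of_mem_jointSpectrum (hA : IsClosed (A : Set (H →L[ℂ] H)))
    (hcomm : ∀ a b : A, a * b = b * a) {n : ℕ} {a : Fin n → A} {μ : Fin n → ℂ}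
    (hμ : μ ∈ jointSpectrum fun i => (a i : H →L[ℂ] H)) :
    ∃ φ : characterSpace ℂ A, ∀ i, φ (a i) = μ i := by
  let _ : CommCStarAlgebra A := { StarSubalgebra.cstarAlgebra A with mul_comm := hcomm }
  set N : Fin n → A := fun i => a i - μ i • 1 with hN
  have hcoe : (fun i => (a i : H →L[ℂ] H) - μ i • 1) = fun i => (N i : H →L[ℂ] H) := rfl
  have hcommute : ∀ b c : A, Commute (b : H →L[ℂ] H) c := fun b c =>
    congr_arg Subtype.val (hcomm b c)
  -- An inverse `u⁻¹` would give the Koszul homotopy with coefficients `N i* u⁻¹`.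
  have hnot : ¬ IsUnit (∑ i, star (N i) * N i) := by
    rintro ⟨u, hu⟩
    refine hμ ?_
    rw [hcoe]
    refine koszulD_exact (B := fun i => ((star (N i) * (↑u⁻¹ : A) : A) : H →L[ℂ] H))
      (fun i j => hcommute _ _) (fun i j => hcommute _ _) ?_
    have h : ∑ i, N i * (star (N i) * (↑u⁻¹ : A)) = 1 := by
      simp_rw [← mul_assoc, ← Finset.sum_mul]
      rw [← u.mul_inv, hu]
      congr 1
      exact Finset.sum_congr rfl fun i _ => mul_comm _ _
    have := congr_arg (fun b : A => (b : H →L[ℂ] H)) h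
    simpa using this
  obtain ⟨φ, hφ⟩ := CharacterSpace.exists_apply_eq_zero hnot
  refine ⟨φ, fun i => ?_⟩
  have hsum : ∑ i, ‖φ (N i)‖ ^ 2 = 0 := by
    rw [map_sum] at hφ
    have h : ∀ i, φ (star (N i) * N i) = ((‖φ (N i)‖ ^ 2 : ℝ) : ℂ) := fun i => by
      rw [map_mul, map_star, Complex.star_def, ← Complex.normSq_eq_conj_mul_self,
        Complex.normSq_eq_norm_sq]
    simp_rw [h] at hφ
    exact_mod_cast hφ
  have h0 := (Finset.sum_eq_zero_iff_of_nonneg fun i _ => by positivity).1 hsum i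
    (Finset.mem_univ i)
  have h1 : φ (N i) = 0 := by simpa using h0
  rw [hN] at h1
  simp only [map_sub, map_smul, map_one, smul_eq_mul, mul_one] at h1
  exact sub_eq_zero.1 h1

/-- Characters separate the points of a commutative C⋆-algebra of operators. -/
theorem eq_of_forall_character (hA : IsClosed (A : Set (H →L[ℂ] H)))
    (hcomm : ∀ a b : A, a * b = b * a) {a b : A} (h : ∀ φ : characterSpace ℂ A, φ a = φ b) :
    a = b := by
  let _ : CommCStarAlgebra A := { StarSubalgebra.cstarAlgebra A with mul_comm := hcomm }
  exact (gelfandTransform_bijective A).injective (ContinuousMap.ext h)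

theorem character_map_star (hA : IsClosed (A : Set (H →L[ℂ] H)))
    (hcomm : ∀ a b : A, a * b = b * a) (φ : characterSpace ℂ A) (a : A) :
    φ (star a) = star (φ a) := by
  let _ : CommCStarAlgebra A := { StarSubalgebra.cstarAlgebra A with mul_comm := hcomm }
  exact map_star φ a

/-- The algebraic relations of a `Γ_n`-unitary, and the joint spectrum of its scaled projection. -/
theorem IsGammaUnitary.relations {m : ℕ} {U : Fin (m + 1) → (H →L[ℂ] H)} (hU : IsGammaUnitary U) :
    star (U (Fin.last m)) * U (Fin.last m) = 1 ∧
      (∀ i : Fin m, U i.castSucc = star (U i.rev.castSucc) * U (Fin.last m)) ∧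
      jointSpectrum (fun i : Fin m => gammaCoeff m i • U i.castSucc) ⊆ symPolydisc m := by
  obtain ⟨hcomm, hnormal, hspec⟩ := hU
  obtain ⟨A, hA, hAcomm, hmem⟩ := exists_commutative_starSubalgebra hcomm hnormal
  let a : Fin (m + 1) → A := fun i => ⟨U i, hmem i⟩
  have hφ : ∀ φ : characterSpace ℂ A, (fun i => φ (a i)) ∈ symPolydiscBoundary (m + 1) :=
    fun φ => hspec (character_mem_jointSpectrum φ a)
  refine ⟨?_, fun i => ?_, fun μ hμ => ?_⟩
  · have h : star (a (Fin.last m)) * a (Fin.last m) = 1 := by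
      refine eq_of_forall_character hA hAcomm fun φ => ?_
      obtain ⟨z, hz, hφz⟩ := hφ φ
      rw [map_mul, character_map_star hA hAcomm, map_one, ← congr_fun hφz (Fin.last m)]
      exact star_mul_symmMap_last hz
    exact congr_arg Subtype.val h
  · have h : a i.castSucc = star (a i.rev.castSucc) * a (Fin.last m) := by
      refine eq_of_forall_character hA hAcomm fun φ => ?_
      obtain ⟨z, hz, hφz⟩ := hφ φ
      rw [map_mul, character_map_star hA hAcomm, ← congr_fun hφz (Fin.last m),
        ← congr_fun hφz i.castSucc, ← congr_fun hφz i.rev.castSucc]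
      exact symmMap_eq_conj_mul hz i
    exact congr_arg Subtype.val h
  · obtain ⟨φ, hφμ⟩ := exists_character_of_mem_jointSpectrum hA hAcomm
      (a := fun i => gammaCoeff m i • a i.castSucc) hμ
    have := gammaCoeff_mul_mem_symPolydisc (symPolydiscBoundary_subset _ (hφ φ))
    convert this using 1
    ext i
    rw [← hφμ i, map_smul, smul_eq_mul]

end Normal

/-! ### Fundamental operators from a lower triangular extension -/

section Triangular

open ContinuousLinearMap

variable {H : Type*} [NormedAddCommGroup H] [InnerProductSpace ℂ H] [CompleteSpace H]

theorem defectMap_denseRange (T : H →L[ℂ] H) : DenseRange (defectMap T) := by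
  intro y
  rw [Topology.IsInducing.subtypeVal.closure_eq_preimage_closure_image, ← Set.range_comp]
  exact y.2

theorem inner_defectOp_left (T : H →L[ℂ] H) (x y : H) :
    ⟪defectOp T x, y⟫_ℂ = ⟪x, defectOp T y⟫_ℂ := by
  have hsa : adjoint (defectOp T) = defectOp T :=
    IsSelfAdjoint.of_nonneg (CFC.sqrt_nonneg (1 - adjoint T * T))
  rw [← adjoint_inner_left, hsa]

theorem inner_defectOp {T : H →L[ℂ] H} (hT : ∀ x, ‖T x‖ ≤ ‖x‖) (x y : H) :
    ⟪defectOp T x, defectOp T y⟫_ℂ = ⟪x, y⟫_ℂ - ⟪T x, T y⟫_ℂ := by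
  have hpos : 0 ≤ 1 - adjoint T * T := by
    rw [nonneg_iff_isPositive, isPositive_iff_complex]
    intro x
    have : ⟪(1 - adjoint T * T) x, x⟫_ℂ = ((‖x‖ ^ 2 - ‖T x‖ ^ 2 : ℝ) : ℂ) := by
      rw [sub_apply, inner_sub_left, mul_apply_eq_comp, adjoint_inner_left]
      simp [inner_self_eq_norm_sq_to_K]
    rw [this]
    refine ⟨by rw [RCLike.re_to_complex, Complex.ofReal_re], ?_⟩
    rw [RCLike.re_to_complex, Complex.ofReal_re, sub_nonneg]
    gcongr
    exact hT x
  have hsq : defectOp T * defectOp T = 1 - adjoint T * T := CFC.sqrt_mul_sqrt_self _ hpos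
  rw [← inner_defectOp_left, ← mul_apply_eq_comp, hsq, sub_apply, inner_sub_left,
    mul_apply_eq_comp, adjoint_inner_left]
  rfl

theorem norm_defectMap {T : H →L[ℂ] H} (hT : ∀ x, ‖T x‖ ≤ ‖x‖) (x : H) :
    ‖defectMap T x‖ ^ 2 = ‖x‖ ^ 2 - ‖T x‖ ^ 2 := by
  have h := inner_defectOp hT x x
  simp only [inner_self_eq_norm_sq_to_K] at h
  change ‖defectOp T x‖ ^ 2 = _
  exact_mod_cast h

/-- If a commuting tuple of operators has the block form `(S_j, 0; C_j, Z_j)` and satisfies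
`V_i = V_{n-i}* V_n` for an isometry `V_n`, then the fundamental operators of `S` are
compressions of the `Z_i`. -/
theorem fundamentalTuple_of_lowerTriangular {m : ℕ} {S : Fin (m + 1) → (H →L[ℂ] H)}
    {E : Fin m → (defectSpace (S (Fin.last m)) →L[ℂ] defectSpace (S (Fin.last m)))}
    (hE : IsFundamentalTuple S E)
    {N : Type*} [NormedAddCommGroup N] [InnerProductSpace ℂ N] [CompleteSpace N]
    (C : Fin (m + 1) → (H →L[ℂ] N)) (Z : Fin (m + 1) → (N →L[ℂ] N))
    (hnorm : ∀ h, ‖C (Fin.last m) h‖ ^ 2 = ‖h‖ ^ 2 - ‖S (Fin.last m) h‖ ^ 2)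
    (hCZ : ∀ (i : Fin m) h x,
      ⟪C i.castSucc h, x⟫_ℂ = ⟪C (Fin.last m) h, Z i.rev.castSucc x⟫_ℂ)
    (hSC : ∀ (i : Fin m) h h',
      ⟪S i.castSucc h, h'⟫_ℂ - ⟪S (Fin.last m) h, S i.rev.castSucc h'⟫_ℂ =
        ⟪C (Fin.last m) h, C i.rev.castSucc h'⟫_ℂ)
    (hcomm : ∀ i j h, C i (S j h) + Z i (C j h) = C j (S i h) + Z j (C i h)) :
    ∃ Θ : defectSpace (S (Fin.last m)) →ₗᵢ[ℂ] N,
      (∀ i, E i = adjoint Θ.toContinuousLinearMap ∘L Z i.castSucc ∘L Θ.toContinuousLinearMap) ∧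
      (∀ (i : Fin m) (h : H), defectOp (S (Fin.last m)) h = 0 →
        adjoint (E i) (defectMap (S (Fin.last m)) (S i.castSucc h)) -
          adjoint (E i.rev) (defectMap (S (Fin.last m)) (S i.rev.castSucc h)) = 0) ∧
      (∀ (i : Fin m) (h : H), defectOp (S (Fin.last m)) h = 0 →
        (adjoint (E i) * adjoint (E i.rev) - adjoint (E i.rev) * adjoint (E i))
          (defectMap (S (Fin.last m)) (S (Fin.last m) h)) = 0) := by
  set Cn := C (Fin.last m) with hCn
  have hcontr : ∀ x, ‖S (Fin.last m) x‖ ≤ ‖x‖ := fun x => by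
    have := hnorm x
    exact (sq_le_sq₀ (norm_nonneg _) (norm_nonneg _)).1 (by nlinarith [sq_nonneg ‖Cn x‖])
  have hdense := defectMap_denseRange (S (Fin.last m))
  have heq : ∀ x, ‖Cn x‖ = ‖defectMap (S (Fin.last m)) x‖ := fun x => by
    rw [← sq_eq_sq₀ (norm_nonneg _) (norm_nonneg _), hnorm, norm_defectMap hcontr]
  -- `D h ↦ C_n h` preserves norms on a dense range, so it extends to an isometry.
  set Θ₀ : defectSpace (S (Fin.last m)) →L[ℂ] N :=
    Cn.toLinearMap.extendOfNorm (defectMap (S (Fin.last m))).toLinearMap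
  have hΘ₀ : ∀ x, Θ₀ (defectMap (S (Fin.last m)) x) = Cn x := fun x =>
    LinearMap.extendOfNorm_eq (e := (defectMap (S (Fin.last m))).toLinearMap) hdense
      ⟨1, fun x => by simpa using (heq x).le⟩ x
  have hΘnorm : ∀ y, ‖Θ₀ y‖ = ‖y‖ := fun y => by
    refine hdense.induction_on (p := fun y => ‖Θ₀ y‖ = ‖y‖) y
      (isClosed_eq (by fun_prop) (by fun_prop)) fun x => ?_
    rw [hΘ₀, heq]
  let Θ : defectSpace (S (Fin.last m)) →ₗᵢ[ℂ] N := ⟨Θ₀.toLinearMap, hΘnorm⟩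
  have hΘ : ∀ x, Θ (defectMap (S (Fin.last m)) x) = Cn x := hΘ₀
  have hEZ : ∀ i, E i =
      adjoint Θ.toContinuousLinearMap ∘L Z i.castSucc ∘L Θ.toContinuousLinearMap := by
    intro i
    refine ContinuousLinearMap.ext fun y => ?_
    refine congr_fun (hdense.equalizer (E i).continuous (ContinuousLinearMap.continuous _)
      (funext fun h => ?_)) y
    -- Tested against `D h'`, both sides equal `⟪C_n h, C_{n-i} h'⟫`.
    refine hdense.eq_of_inner_left ℂ fun h' => ?_
    have h1 : ⟪E i (defectMap (S (Fin.last m)) h), defectMap (S (Fin.last m)) h'⟫_ℂ =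
        ⟪Cn h, C i.rev.castSucc h'⟫_ℂ := by
      rw [← hSC]
      have := congr($(hE i) h)
      rw [← adjoint_inner_left (S i.rev.castSucc), ← inner_sub_left]
      change _ = ⟪(S i.castSucc - adjoint (S i.rev.castSucc) * S (Fin.last m)) h, h'⟫_ℂ
      rw [this]
      change _ = ⟪defectOp (S (Fin.last m)) (E i (defectMap (S (Fin.last m)) h) : H), h'⟫_ℂ
      rw [inner_defectOp_left]
      rfl
    simp only [Function.comp_apply]
    rw [h1, comp_apply, adjoint_inner_left, comp_apply]
    change _ =
      ⟪Z i.castSucc (Θ (defectMap (S (Fin.last m)) h)), Θ (defectMap (S (Fin.last m)) h')⟫_ℂ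
    rw [hΘ, hΘ, ← inner_conj_symm, hCZ, Fin.rev_rev, inner_conj_symm]
  have hEC : ∀ (i : Fin m) g, adjoint (E i) (defectMap (S (Fin.last m)) g) =
      adjoint Θ.toContinuousLinearMap (C i.rev.castSucc g) := by
    intro i g
    refine ext_inner_right ℂ fun y => ?_
    rw [adjoint_inner_left, adjoint_inner_left, hCZ, Fin.rev_rev, hEZ, comp_apply,
      adjoint_inner_right, comp_apply]
    change ⟪Θ (defectMap (S (Fin.last m)) g), _⟫_ℂ = _
    rw [hΘ]
  have hΘΘ : ∀ g, adjoint Θ.toContinuousLinearMap (Cn g) = defectMap (S (Fin.last m)) g := by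
    intro g
    refine ext_inner_right ℂ fun y => ?_
    rw [adjoint_inner_left, ← hΘ]
    exact Θ.inner_map_map _ _
  have hC0 : ∀ h, defectOp (S (Fin.last m)) h = 0 → Cn h = 0 ∧ ∀ i : Fin m, C i.castSucc h = 0 := by
    intro h hh
    have hn : Cn h = 0 := by
      rw [← hΘ, show defectMap (S (Fin.last m)) h = 0 from Subtype.ext hh, map_zero]
    refine ⟨hn, fun i => ext_inner_right ℂ fun x => ?_⟩
    rw [hCZ, hn, inner_zero_left, inner_zero_left]
  have h2 : ∀ (i : Fin m) (h : H), defectOp (S (Fin.last m)) h = 0 →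
      adjoint (E i) (defectMap (S (Fin.last m)) (S i.castSucc h)) -
        adjoint (E i.rev) (defectMap (S (Fin.last m)) (S i.rev.castSucc h)) = 0 := by
    intro i h hh
    have hc := hcomm i.rev.castSucc i.castSucc h
    rw [(hC0 h hh).2, (hC0 h hh).2, map_zero, map_zero, add_zero, add_zero] at hc
    rw [hEC, hEC, Fin.rev_rev, hc, sub_self]
  -- On `ker D`, `C_{n-i} S_n = C_n S_{n-i}` and `Θ* C_n = D`. Applying the outer adjoint then
  -- reduces the commutator identity to `h2`.
  have h3 : ∀ (i : Fin m) (h : H), defectOp (S (Fin.last m)) h = 0 →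
      adjoint (E i) (defectMap (S (Fin.last m)) (S (Fin.last m) h)) =
        defectMap (S (Fin.last m)) (S i.rev.castSucc h) := by
    intro i h hh
    have hc := hcomm i.rev.castSucc (Fin.last m) h
    rw [(hC0 h hh).2, ← hCn, (hC0 h hh).1, map_zero, map_zero, add_zero, add_zero] at hc
    rw [hEC, hc, hΘΘ]
  refine ⟨Θ, hEZ, h2, fun i h hh => ?_⟩
  rw [sub_apply, mul_apply_eq_comp, mul_apply_eq_comp, h3 _ h hh, h3 _ h hh, Fin.rev_rev]
  exact h2 i h hh

end Triangular

/-! ### The part of a dilation orthogonal to the original space -/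

section Dilation

open ContinuousLinearMap

/-- Commutativity moves the extra factor to its own slot, so ordered monomials, the only ones in the
dilation identity, suffice. -/
theorem List.prod_ofFn_pow_mul {M : Type*} [Monoid M] {n : ℕ} {a : Fin n → M}
    (ha : ∀ i j, Commute (a i) (a j)) (e : Fin n → ℕ) (j : Fin n) :
    (List.ofFn fun i => a i ^ e i).prod * a j =
      (List.ofFn fun i => a i ^ (e + Pi.single j 1 : Fin n → ℕ) i).prod := by
  induction n with
  | zero => exact j.elim0
  | succ n ih =>
    rw [List.ofFn_succ, List.ofFn_succ, List.prod_cons, List.prod_cons]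
    refine Fin.cases ?_ (fun j => ?_) j
    · have hc : Commute (List.ofFn fun i : Fin n => a i.succ ^ e i.succ).prod (a 0) := by
        refine Commute.list_prod_left _ _ fun x hx => ?_
        obtain ⟨i, rfl⟩ := List.mem_ofFn.1 hx
        exact (ha _ _).pow_left _
      rw [mul_assoc, hc.eq, ← mul_assoc, ← pow_succ]
      simp
    · have := ih (a := fun i => a i.succ) (fun i k => ha _ _) (fun i => e i.succ) j
      rw [mul_assoc, this]
      simp [Pi.single_apply]

variable {H : Type*} [NormedAddCommGroup H] [InnerProductSpace ℂ H] [CompleteSpace H]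
  {K : Type*} [NormedAddCommGroup K] [InnerProductSpace ℂ K] [CompleteSpace K]

/-- The largest subspace that is invariant under the commuting tuple `V` and orthogonal to the
range of `J`. -/
noncomputable def invariantComplement {n : ℕ} (J : H →ₗᵢ[ℂ] K) (V : Fin n → (K →L[ℂ] K)) :
    Submodule ℂ K :=
  ⨅ e : Fin n → ℕ, LinearMap.ker
    (adjoint J.toContinuousLinearMap ∘L (List.ofFn fun i => V i ^ e i).prod).toLinearMap

variable {n : ℕ} {J : H →ₗᵢ[ℂ] K} {V : Fin n → (K →L[ℂ] K)}

theorem mem_invariantComplement {x : K} : x ∈ invariantComplement J V ↔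
    ∀ e : Fin n → ℕ, adjoint J.toContinuousLinearMap ((List.ofFn fun i => V i ^ e i).prod x) = 0 := by
  simp [invariantComplement]

theorem isClosed_invariantComplement : IsClosed (invariantComplement J V : Set K) := by
  rw [invariantComplement, Submodule.coe_iInf]
  exact isClosed_iInter fun e => ContinuousLinearMap.isClosed_ker _

theorem apply_mem_invariantComplement (hV : CommutingTuple V) {x : K}
    (hx : x ∈ invariantComplement J V) (j : Fin n) : V j x ∈ invariantComplement J V := by
  rw [mem_invariantComplement] at hx ⊢
  intro e
  rw [← mul_apply_eq_comp, List.prod_ofFn_pow_mul hV]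
  exact hx _

theorem inner_eq_zero_of_mem_invariantComplement {x : K}
    (hx : x ∈ invariantComplement J V) (h : H) : ⟪J h, x⟫_ℂ = 0 := by
  have := mem_invariantComplement.1 hx 0
  simp only [Pi.zero_apply, pow_zero, List.ofFn_const, List.prod_replicate, one_pow,
    one_apply_eq_self] at this
  have h2 := adjoint_inner_right J.toContinuousLinearMap h x
  rw [this, inner_zero_right] at h2
  exact h2.symm

variable {S : Fin n → (H →L[ℂ] H)}

/-- Compressing a monomial `V^e` applied to either term gives `S^e S_j h`. This is what makes `V`
lower triangular on `H ⊕ N`. -/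
theorem sub_mem_invariantComplement (hV : CommutingTuple V) (hS : CommutingTuple S)
    (hdil : ∀ e : Fin n → ℕ, adjoint J.toContinuousLinearMap ∘L
      (List.ofFn fun i => V i ^ e i).prod ∘L J.toContinuousLinearMap =
        (List.ofFn fun i => S i ^ e i).prod) (j : Fin n) (h : H) :
    V j (J h) - J (S j h) ∈ invariantComplement J V := by
  rw [mem_invariantComplement]
  intro e
  have h1 : adjoint J.toContinuousLinearMap
      ((List.ofFn fun i => V i ^ (e + Pi.single j 1 : Fin n → ℕ) i).prod (J h)) =
        (List.ofFn fun i => S i ^ (e + Pi.single j 1 : Fin n → ℕ) i).prod h := congr($(hdil _) h)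
  have h2 : adjoint J.toContinuousLinearMap
      ((List.ofFn fun i => V i ^ e i).prod (J (S j h))) =
        (List.ofFn fun i => S i ^ e i).prod (S j h) := congr($(hdil e) (S j h))
  rw [map_sub, map_sub, ← mul_apply_eq_comp, List.prod_ofFn_pow_mul hV, h1, h2,
    ← mul_apply_eq_comp (List.ofFn fun i => S i ^ e i).prod, List.prod_ofFn_pow_mul hS, sub_self]

end Dilation

/-! ### Assembly: block form of the dilation and the normal extension -/

theorem theorem2p7 {H : Type u} [NormedAddCommGroup H] [InnerProductSpace ℂ H] [CompleteSpace H]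
    (m : ℕ) (hm : 2 ≤ m + 1)
    (S : Fin (m + 1) → (H →L[ℂ] H)) (hS : IsGammaContraction S)
    (E : Fin m → (defectSpace (S (Fin.last m)) →L[ℂ] defectSpace (S (Fin.last m))))
    (hE : IsFundamentalTuple S E)
    (hdil : HasGammaIsometricDilation.{u, v, w} S) :
    (∃ (Ht : Type v) (_ : NormedAddCommGroup Ht) (_ : InnerProductSpace ℂ Ht)
        (_ : CompleteSpace Ht) (Θ : defectSpace (S (Fin.last m)) →ₗᵢ[ℂ] Ht)
        (St : Fin m → (Ht →L[ℂ] Ht)),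
        CommutingTuple (fun i => gammaCoeff m i • St i) ∧
        (∀ i, gammaCoeff m i • E i =
          ContinuousLinearMap.adjoint Θ.toContinuousLinearMap ∘L (gammaCoeff m i • St i) ∘L
            Θ.toContinuousLinearMap) ∧
        ∃ (L : Type w) (_ : NormedAddCommGroup L) (_ : InnerProductSpace ℂ L)
          (_ : CompleteSpace L) (J : Ht →ₗᵢ[ℂ] L) (U : Fin m → (L →L[ℂ] L)),
          CommutingTuple (fun i => gammaCoeff m i • U i) ∧
          (∀ i, IsStarNormal (gammaCoeff m i • U i)) ∧
          (∀ i x, (gammaCoeff m i • U i) (J x) = J ((gammaCoeff m i • St i) x)) ∧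
          jointSpectrum (fun i => gammaCoeff m i • U i) ⊆ symPolydisc m) ∧
    (∀ (i : Fin m) (h : H), defectOp (S (Fin.last m)) h = 0 →
      ContinuousLinearMap.adjoint (E i) (defectMap (S (Fin.last m)) (S i.castSucc h)) -
        ContinuousLinearMap.adjoint (E i.rev)
          (defectMap (S (Fin.last m)) (S i.rev.castSucc h)) = 0) ∧
    (∀ (i : Fin m) (h : H), defectOp (S (Fin.last m)) h = 0 →
      (ContinuousLinearMap.adjoint (E i) * ContinuousLinearMap.adjoint (E i.rev) -
          ContinuousLinearMap.adjoint (E i.rev) * ContinuousLinearMap.adjoint (E i))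
        (defectMap (S (Fin.last m)) (S (Fin.last m) h)) = 0) := by
  obtain ⟨K, _, _, _, J, V, ⟨hV, L, _, _, _, J', U, hU, hUV⟩, hdil⟩ := hdil
  obtain ⟨hiso, hrel, hspec⟩ := hU.relations
  have hScomm := hS.1
  -- Inner products may be computed in `L`, where `V` acts as `U`; the relations for `U` thus pass
  -- to `V` in weak form.
  have hVn : ∀ x y, ⟪V (Fin.last m) x, V (Fin.last m) y⟫_ℂ = ⟪x, y⟫_ℂ := fun x y => by
    rw [← J'.inner_map_map, ← hUV, ← hUV, ← ContinuousLinearMap.adjoint_inner_left]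
    have := congr($hiso (J' x))
    rw [ContinuousLinearMap.star_eq_adjoint, mul_apply_eq_comp, one_apply_eq_self] at this
    rw [this, J'.inner_map_map]
  have hVi : ∀ (i : Fin m) x y,
      ⟪V i.castSucc x, y⟫_ℂ = ⟪V (Fin.last m) x, V i.rev.castSucc y⟫_ℂ := fun i x y => by
    rw [← J'.inner_map_map, ← J'.inner_map_map (V (Fin.last m) x), ← hUV, ← hUV, ← hUV,
      ← ContinuousLinearMap.adjoint_inner_left]
    have := congr($(hrel i) (J' x))
    rw [ContinuousLinearMap.star_eq_adjoint, mul_apply_eq_comp] at this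
    rw [this]
  set N := invariantComplement J V
  have hNV : ∀ j (x : N), V j x ∈ N := fun j x => apply_mem_invariantComplement hV x.2 j
  have hNJ : ∀ h (x : N), ⟪J h, (x : K)⟫_ℂ = 0 := fun h x =>
    inner_eq_zero_of_mem_invariantComplement x.2 h
  have hsub : ∀ j h, V j (J h) - J (S j h) ∈ N := sub_mem_invariantComplement hV hScomm hdil
  have : CompleteSpace N := isClosed_invariantComplement.completeSpace_coe
  let Z : Fin (m + 1) → (N →L[ℂ] N) := fun j => ((V j) ∘L N.subtypeL).codRestrict N (hNV j)
  let C : Fin (m + 1) → (H →L[ℂ] N) := fun j =>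
    (V j ∘L J.toContinuousLinearMap - J.toContinuousLinearMap ∘L S j).codRestrict N (hsub j)
  have hZ : ∀ j x, (Z j x : K) = V j x := fun j x => rfl
  have hC : ∀ j h, (C j h : K) = V j (J h) - J (S j h) := fun j h => rfl
  have hCx : ∀ j h (x : N), ⟪C j h, x⟫_ℂ = ⟪V j (J h), (x : K)⟫_ℂ := fun j h x => by
    rw [Submodule.coe_inner, hC, inner_sub_left, hNJ, sub_zero]
  have hxJ : ∀ h (x : N), ⟪(x : K), J h⟫_ℂ = 0 := fun h x => by
    rw [← inner_conj_symm, hNJ, map_zero]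
  have hSV : ∀ j h h', ⟪V j (J h), J h'⟫_ℂ = ⟪S j h, h'⟫_ℂ := fun j h h' => by
    have := hxJ h' (C j h)
    rw [hC, inner_sub_left, J.inner_map_map, sub_eq_zero] at this
    exact this
  have hSV' : ∀ j h h', ⟪J h, V j (J h')⟫_ℂ = ⟪h, S j h'⟫_ℂ := fun j h h' => by
    rw [← inner_conj_symm, hSV, inner_conj_symm]
  have hnorm : ∀ h, ‖C (Fin.last m) h‖ ^ 2 = ‖h‖ ^ 2 - ‖S (Fin.last m) h‖ ^ 2 := fun h => by
    have h1 := hCx (Fin.last m) h (C (Fin.last m) h)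
    rw [hC, inner_sub_right, hVn, J.inner_map_map, hSV] at h1
    simp only [inner_self_eq_norm_sq_to_K] at h1
    exact_mod_cast h1
  obtain ⟨Θ, hΘ, h2, h3⟩ := fundamentalTuple_of_lowerTriangular hE C Z hnorm
    (fun i h x => by rw [hCx, hCx, hZ, hVi])
    (fun i h h' => by rw [hCx, hC, inner_sub_right, ← hVi, hSV, hSV])
    (fun i j h => by
      refine Subtype.ext ?_
      have h1 : V i (V j (J h)) = V j (V i (J h)) := congr($(hV i j) (J h))
      have h2 : S i (S j h) = S j (S i h) := congr($(hScomm i j) h)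
      simp only [Submodule.coe_add, hC, hZ, map_sub]
      rw [h1, h2]
      abel)
  -- The space is `N` itself with `St i = Z i.castSucc`; the normal extension acts on `L` through `N
  -- ⊆ K ⊆ L`.
  refine ⟨⟨N, inferInstance, inferInstance, this, Θ, fun i => Z i.castSucc, ?_, fun i => ?_,
    L, inferInstance, inferInstance, inferInstance, J'.comp N.subtypeₗᵢ,
    fun i => U i.castSucc, ?_, ?_, ?_, hspec⟩, h2, h3⟩
  · refine fun i j => ((?_ : Commute _ _).smul_left _).smul_right _
    ext x
    exact congr($(hV i.castSucc j.castSucc) (x : K))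
  · rw [hΘ i, ContinuousLinearMap.smul_comp, ContinuousLinearMap.comp_smul]
  · exact fun i j => ((hU.1 _ _).smul_left _).smul_right _
  · intro i
    have := hU.2.1 i.castSucc
    refine ⟨?_⟩
    rw [star_smul]
    exact (this.star_comm_self.smul_left _).smul_right _
  · intro i x
    simp only [smul_apply, map_smul]
    congr 1
    exact hUV _ _
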